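/- Let $\mathfrak l$ be a real Lie algebra and $(\mathfrak a,\langle\cdot,\cdot\rangle)$ a finite-dimensional real vector space with a non-degenerate symmetric bilinear form, regarded as a trivial $\mathfrak l$-module. Let $(C^*(\mathfrak l,\mathfrak a),d)$ be the Chevalley–Eilenberg complex and $C^*(\mathfrak l)=C^*(\mathfrak l,\mathbb R)$; for cochains with values in $\mathfrak a$ let $\langle\cdot\wedge\cdot\rangle$ be the exterior product followed by the inner product. Let $$\mathcal Z^2_Q(\mathfrak l,\mathfrak a)=\{(\alpha,\gamma)\in C^2(\mathfrak l,\mathfrak a)\oplus C^3(\mathfrak l)\mid d\alpha=0,\ d\gamma=\tfrac12\langle\alpha\wedge\alpha\rangle\},$$ and let $\mathcal H^2_Q(\mathfrak l,\mathfrak a)$ be the set of classes $[\alpha,\gamma]$ of its elements, where $(\alpha,\gamma)$ is identified with $(\alpha+d\tau,\ \gamma+d\sigma+\langle(\alpha+\tfrac12d\tau)\wedge\tau\rangle)$ for all $\tau\in C^1(\mathfrak l,\mathfrak a)$, $\sigma\in C^2(\mathfrak l)$. Write $\mathfrak l^1=\mathfrak l$, $\mathfrak l^{j+1}=[\mathfrak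 l,\mathfrak l^{j}]$, let $\mathfrak z(\mathfrak l)$ be the centre, $\mathfrak l_{(0)}=\mathfrak z(\mathfrak l)$ and $\mathfrak l_{(k)}=\mathfrak z(\mathfrak l)\cap\mathfrak l^{k+1}$ for $k\ge1$. Suppose that $\mathfrak l$ is nilpotent, and let $m\ge 0$ be such that $\mathfrak l^{m+2}=0$. A class $[\alpha,\gamma]$ is *admissible* if for all $0\le k\le m$ the following two conditions hold (they do not depend on the choices of $m$ and of the representative). * $(A_k)$ If $L_0\in\mathfrak l_{(k)}$, and there are $A_0\in\mathfrak a$ and $Z_0\in(\mathfrak l^{k+1})^*$ such that for all $L\in\mathfrak l$ one has $\alpha(L,L_0)=0$ and $\gamma(L,L_0,\cdot)=-\langle A_0,\alpha(L,\cdot)\rangle+Z_0([L,\cdot])$ on $\mathfrak l^{k+1}$, then $L_0=0$. * $(B_k)$ The image under $\alpha$ of the kernel of the bracket map $\mathfrak l\otimes\mathfrak l^{k+1}\to\mathfrak l$ is a non-degenerate subspace of $\mathfrak a$. A class $\varphi\in\mathcal H^2_Q(\mathfrak l,\mathfrak a)$ is *decomposable* if there are an orthogonal decomposition $\mathfrak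 a=\mathfrak a_1\oplus\mathfrak a_2$ and a decomposition $\mathfrak l=\mathfrak l_1\oplus\mathfrak l_2$ into ideals, at least one of the two having both summands non-zero, and classes $\varphi_i=[\alpha_i,\gamma_i]\in\mathcal H^2_Q(\mathfrak l_i,\mathfrak a_i)$ such that $\varphi=[\,j_1q_1^*\alpha_1+j_2q_2^*\alpha_2,\ q_1^*\gamma_1+q_2^*\gamma_2\,]$, where $q_i:\mathfrak l\to\mathfrak l_i$ are the projections and $j_i:\mathfrak a_i\to\mathfrak a$ the inclusions. Let $\mathcal H^2_Q(\mathfrak l,\mathfrak a)_0$ be the set of admissible classes that are not decomposable. **Proposition.** Let $\mathfrak l$ be a nilpotent real Lie algebra with $\dim\mathfrak l=5$, and let $\mathfrak a=0$. If $\mathcal H^2_Q(\mathfrak l,\mathfrak a)_0\neq\emptyset$, then $\mathfrak l$ is isomorphic to the abelian Lie algebra $\mathbb R^5$ or to the Lie algebra $\mathfrak g_{5,2}$ with basis $X_1,X_2,X_3,Y,Z$ and brackets $[X_1,X_2]=Y$, $[X_1,X_3]=Z$, all other brackets of basis vectors being zero. -/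

import Mathlib

/-! # Quadratic cohomology of real Lie algebras and admissible, indecomposable classes -/

namespace QuadraticCohomology

/-- A finite-dimensional pseudo-Euclidean vector space: a finite-dimensional real vector space
with a non-degenerate symmetric bilinear form. -/
structure PseudoEuclidean (A : Type*) [AddCommGroup A] [Module ℝ A] where
  /-- the inner product -/
  form : LinearMap.BilinForm ℝ A
  finite : FiniteDimensional ℝ A
  symm : ∀ a b, form a b = form b a
  nondegenerate : form.Nondegenerate

/-- An orthogonal module of a Lie algebra `L`: a pseudo-Euclidean space with a representation of
`L` by skew-symmetric maps. -/
structure OrthogonalModule (L A : Type*) [LieRing L] [LieAlgebra ℝ L]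
    [AddCommGroup A] [Module ℝ A] extends PseudoEuclidean A where
  /-- the representation -/
  rho : L →ₗ[ℝ] Module.End ℝ A
  rho_lie : ∀ (x y : L) (a : A), rho ⁅x, y⁆ a = rho x (rho y a) - rho y (rho x a)
  skew : ∀ (x : L) (a b : A), form (rho x a) b + form a (rho x b) = 0

section Cochains

variable {L A : Type*} [LieRing L] [LieAlgebra ℝ L] [AddCommGroup A] [Module ℝ A]

/-- A pseudo-Euclidean space as a trivial orthogonal module of `L`. -/
def PseudoEuclidean.trivialModule (L : Type*) [LieRing L] [LieAlgebra ℝ L]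
    (E : PseudoEuclidean A) : OrthogonalModule L A where
  toPseudoEuclidean := E
  rho := 0
  rho_lie := by intro x y a; simp
  skew := by intro x a b; simp

/-- The differential `C¹(L, A) → C²(L, A)`; one-cochains are linear maps. -/
def d1 (V : OrthogonalModule L A) (τ : L →ₗ[ℝ] A) (x y : L) : A :=
  V.rho x (τ y) - V.rho y (τ x) - τ ⁅x, y⁆

/-- The differential `C²(L, A) → C³(L, A)`. -/
def d2 (V : OrthogonalModule L A) (α : L [⋀^Fin 2]→ₗ[ℝ] A) (x y z : L) : A :=
  V.rho x (α ![y, z]) - V.rho y (α ![x, z]) + V.rho z (α ![x, y])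
    - α ![⁅x, y⁆, z] + α ![⁅x, z⁆, y] - α ![⁅y, z⁆, x]

/-- The differential `C²(L) → C³(L)` for the trivial module `ℝ`. -/
def d2R (σ : L [⋀^Fin 2]→ₗ[ℝ] ℝ) (x y z : L) : ℝ :=
  - σ ![⁅x, y⁆, z] + σ ![⁅x, z⁆, y] - σ ![⁅y, z⁆, x]

/-- The differential `C³(L) → C⁴(L)` for the trivial module `ℝ`. -/
def d3R (γ : L [⋀^Fin 3]→ₗ[ℝ] ℝ) (x y z w : L) : ℝ :=
  - γ ![⁅x, y⁆, z, w] + γ ![⁅x, z⁆, y, w] - γ ![⁅x, w⁆, y, z]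
    - γ ![⁅y, z⁆, x, w] + γ ![⁅y, w⁆, x, z] - γ ![⁅z, w⁆, x, y]

/-- The product `⟨τ₁ ∧ τ₂⟩` of two one-cochains. -/
def wedge11 (B : LinearMap.BilinForm ℝ A) (τ₁ τ₂ : L →ₗ[ℝ] A) : L [⋀^Fin 2]→ₗ[ℝ] ℝ where
  toFun v := B (τ₁ (v 0)) (τ₂ (v 1)) - B (τ₁ (v 1)) (τ₂ (v 0))
  map_update_add' := by
    intro inst v i x y
    rw [Subsingleton.elim inst (instDecidableEqFin 2)]
    fin_cases i <;> simp <;> ring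
  map_update_smul' := by
    intro inst v i c x
    rw [Subsingleton.elim inst (instDecidableEqFin 2)]
    fin_cases i <;> simp <;> ring
  map_eq_zero_of_eq' := by
    intro v i j h hij
    fin_cases i <;> fin_cases j <;> simp_all

/-- The product `⟨β ∧ τ⟩` of a two-cochain (given as a function) and a one-cochain. -/
def wedge21 (B : LinearMap.BilinForm ℝ A) (β : L → L → A) (τ : L →ₗ[ℝ] A) (x y z : L) : ℝ :=
  B (β x y) (τ z) - B (β x z) (τ y) + B (β y z) (τ x)

/-- The product `⟨α ∧ β⟩` of two two-cochains. -/
def wedge22 (B : LinearMap.BilinForm ℝ A) (α β : L [⋀^Fin 2]→ₗ[ℝ] A) (x y z w : L) : ℝ :=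
  B (α ![x, y]) (β ![z, w]) - B (α ![x, z]) (β ![y, w]) + B (α ![x, w]) (β ![y, z])
    + B (α ![y, z]) (β ![x, w]) - B (α ![y, w]) (β ![x, z]) + B (α ![z, w]) (β ![x, y])

/-- Quadratic two-cocycles: pairs `(α, γ) ∈ C²(L, A) ⊕ C³(L)` with `dα = 0` and
`dγ = ½ ⟨α ∧ α⟩`. -/
structure QuadCocycle (V : OrthogonalModule L A) where
  /-- the part in `C²(L, A)` -/
  α : L [⋀^Fin 2]→ₗ[ℝ] A
  /-- the part in `C³(L)` -/
  γ : L [⋀^Fin 3]→ₗ[ℝ] ℝ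
  d_α : ∀ x y z, d2 V α x y z = 0
  d_γ : ∀ x y z w, d3R γ x y z w = 1 / 2 * wedge22 V.form α α x y z w

/-- `(α', γ')` is the image of `(α, γ)` under the quadratic one-cochain `(τ, σ)`, that is
`α' = α + dτ` and `γ' = γ + dσ + ⟨(α + ½ dτ) ∧ τ⟩`. -/
def Moves (V : OrthogonalModule L A) (τ : L →ₗ[ℝ] A) (σ : L [⋀^Fin 2]→ₗ[ℝ] ℝ)
    (c c' : QuadCocycle V) : Prop :=
  (∀ x y, c'.α ![x, y] = c.α ![x, y] + d1 V τ x y) ∧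
  (∀ x y z, c'.γ ![x, y, z] = c.γ ![x, y, z] + d2R σ x y z
    + wedge21 V.form (fun u v => c.α ![u, v] + (1 / 2 : ℝ) • d1 V τ u v) τ x y z)

theorem Moves.refl (V : OrthogonalModule L A) (c : QuadCocycle V) : Moves V 0 0 c c := by
  constructor <;> intros <;> simp [d1, d2R, wedge21]

theorem Moves.inv {V : OrthogonalModule L A} {τ : L →ₗ[ℝ] A} {σ : L [⋀^Fin 2]→ₗ[ℝ] ℝ}
    {c c' : QuadCocycle V} (h : Moves V τ σ c c') : Moves V (-τ) (-σ) c' c := by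
  obtain ⟨h1, h2⟩ := h
  constructor
  · intro x y
    rw [h1]
    simp only [d1, LinearMap.neg_apply, map_neg]
    abel
  · intro x y z
    rw [h2]
    simp only [h1, d1, d2R, wedge21, LinearMap.neg_apply, map_neg, map_add, map_sub, map_smul,
      LinearMap.add_apply, LinearMap.sub_apply, LinearMap.smul_apply, smul_eq_mul,
      AlternatingMap.neg_apply]
    ring

/-- Two moves compose according to the group law
`(τ, σ) * (τ', σ') = (τ + τ', σ + σ' + ½ ⟨τ ∧ τ'⟩)` of quadratic one-cochains. -/
theorem Moves.comp {V : OrthogonalModule L A} {τ τ' : L →ₗ[ℝ] A}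
    {σ σ' : L [⋀^Fin 2]→ₗ[ℝ] ℝ} {c c' c'' : QuadCocycle V}
    (h : Moves V τ σ c c') (h' : Moves V τ' σ' c' c'') :
    Moves V (τ + τ') (σ + σ' + (1 / 2 : ℝ) • wedge11 V.form τ τ') c c'' := by
  obtain ⟨h1, h2⟩ := h
  obtain ⟨h1', h2'⟩ := h'
  constructor
  · intro x y
    rw [h1', h1]
    simp only [d1, LinearMap.add_apply, map_add]
    abel
  · intro x y z
    rw [h2', h2]
    have sk : ∀ (u : L) (a b : A), V.form (V.rho u a) b = - V.form (V.rho u b) a := by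
      intro u a b
      have := V.skew u a b
      rw [V.symm a] at this
      linarith
    have e : ∀ u v w : L, wedge11 V.form τ τ' ![⁅u, v⁆, w]
        = V.form (τ ⁅u, v⁆) (τ' w) - V.form (τ' ⁅u, v⁆) (τ w) := by
      intro u v w
      rw [V.symm (τ' ⁅u, v⁆)]
      rfl
    simp only [h1, d1, d2R, wedge21, LinearMap.add_apply, map_add, map_sub, map_smul,
      LinearMap.sub_apply, LinearMap.smul_apply, smul_eq_mul,
      AlternatingMap.add_apply, AlternatingMap.smul_apply, e]
    rw [sk x (τ y) (τ' z), sk y (τ x) (τ' z), sk x (τ z) (τ' y), sk z (τ x) (τ' y),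
      sk y (τ z) (τ' x), sk z (τ y) (τ' x)]
    ring

/-- Two quadratic cocycles are equivalent if they lie in the same orbit of the group of
quadratic one-cochains. -/
def quadSetoid (V : OrthogonalModule L A) : Setoid (QuadCocycle V) where
  r c c' := ∃ τ σ, Moves V τ σ c c'
  iseqv :=
    ⟨fun c => ⟨_, _, Moves.refl V c⟩, fun ⟨_, _, h⟩ => ⟨_, _, h.inv⟩,
      fun ⟨_, _, h⟩ ⟨_, _, h'⟩ => ⟨_, _, h.comp h'⟩⟩

/-- The second quadratic cohomology set of `L` with coefficients in `V`. -/
def HQ (V : OrthogonalModule L A) : Type _ := Quotient (quadSetoid V)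

/-- The class `[α, γ]` of a quadratic cocycle. -/
def QuadCocycle.cls {V : OrthogonalModule L A} (c : QuadCocycle V) : HQ V :=
  Quotient.mk (quadSetoid V) c

/-! ### Admissible classes

In terms of the lower central series `L¹ = L`, `Lʲ⁺¹ = [L, Lʲ]`, the term `Lᵏ⁺¹` is
`LieModule.lowerCentralSeries ℝ L L k`. -/

/-- The term `Lᵏ⁺¹` of the lower central series. -/
abbrev lcs (L : Type*) [LieRing L] [LieAlgebra ℝ L] (k : ℕ) : LieSubmodule ℝ L L :=
  LieModule.lowerCentralSeries ℝ L L k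

/-- The subspaces `L₍₀₎ = 𝔷(L) ∩ ker ρ` and `L₍ₖ₎ = 𝔷(L) ∩ Lᵏ⁺¹` for `k ≥ 1`. -/
def centralPart (V : OrthogonalModule L A) : ℕ → Submodule ℝ L
  | 0 => (LieAlgebra.center ℝ L).toSubmodule ⊓ LinearMap.ker V.rho
  | k + 1 => (LieAlgebra.center ℝ L).toSubmodule ⊓ (lcs L (k + 1)).toSubmodule

/-- Condition `(Aₖ)`. -/
def CondA (V : OrthogonalModule L A) (c : QuadCocycle V) (k : ℕ) : Prop :=
  ∀ L₀ ∈ centralPart V k,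
    (∃ (A₀ : A) (Z₀ : Module.Dual ℝ (lcs L k)), ∀ x : L,
      c.α ![x, L₀] = 0 ∧
      ∀ y : lcs L k, c.γ ![x, L₀, (y : L)] = - V.form A₀ (c.α ![x, (y : L)]) + Z₀ ⁅x, y⁆) →
    L₀ = 0

theorem update_pair_zero {M : Type*} (x y a : M) : Function.update ![x, y] 0 a = ![a, y] := by
  ext i; fin_cases i <;> rfl

theorem update_pair_one {M : Type*} (x y a : M) : Function.update ![x, y] 1 a = ![x, a] := by
  ext i; fin_cases i <;> rfl

/-- A two-cochain as a bilinear map. -/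
def bilin (α : L [⋀^Fin 2]→ₗ[ℝ] A) : L →ₗ[ℝ] L →ₗ[ℝ] A :=
  LinearMap.mk₂ ℝ (fun x y => α ![x, y])
    (fun x x' y => by
      have h := α.map_update_add ![x, y] 0 x x'
      rwa [update_pair_zero, update_pair_zero, update_pair_zero] at h)
    (fun r x y => by
      have h := α.map_update_smul ![x, y] 0 r x
      rwa [update_pair_zero, update_pair_zero] at h)
    (fun x y y' => by
      have h := α.map_update_add ![x, y] 1 y y'
      rwa [update_pair_one, update_pair_one, update_pair_one] at h)
    (fun r x y => by
      have h := α.map_update_smul ![x, y] 1 r y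
      rwa [update_pair_one, update_pair_one] at h)

/-- The subspace `α(ker [·,·]_{L ⊗ Lᵏ⁺¹})` of `A`. -/
def kernelImage (α : L [⋀^Fin 2]→ₗ[ℝ] A) (k : ℕ) : Submodule ℝ A :=
  (LinearMap.ker
      (LieModule.toModuleHom ℝ L (lcs L k) : TensorProduct ℝ L (lcs L k) →ₗ[ℝ] lcs L k)).map
    (TensorProduct.lift ((bilin α).compl₂ (lcs L k).toSubmodule.subtype))

/-- Condition `(Bₖ)`. -/
def CondB (V : OrthogonalModule L A) (c : QuadCocycle V) (k : ℕ) : Prop :=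
  (V.form.restrict (kernelImage c.α k)).Nondegenerate

/-- Admissible classes in `H²_Q(L, V)`, for `L` nilpotent and `V` semi-simple: the class has a
representative `(α, γ)` with `α(L, L) ⊆ Aᴸ` such that `(Aₖ)` and `(Bₖ)` hold for `0 ≤ k ≤ m`, where
`Lᵐ⁺² = 0`. -/
def Admissible (V : OrthogonalModule L A) (φ : HQ V) : Prop :=
  ∃ c : QuadCocycle V, c.cls = φ ∧ (∀ x y z : L, V.rho z (c.α ![x, y]) = 0) ∧
    ∃ m : ℕ, lcs L (m + 1) = ⊥ ∧ ∀ k ≤ m, CondA V c k ∧ CondB V c k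

end Cochains

section Decomposable

variable (L : Type*) [LieRing L] [LieAlgebra ℝ L] {A : Type*} [AddCommGroup A] [Module ℝ A]

/-- A class `φ ∈ H²_Q(L, A)`, `A` a trivial module, is decomposable if there are an orthogonal
decomposition `A = a₁ ⊕ a₂` and a decomposition `L = I₁ ⊕ I₂` into ideals, at least one of them
non-trivial, and classes `φᵢ ∈ H²_Q(Iᵢ, aᵢ)` with `φ = (q₁, j₁)^* φ₁ + (q₂, j₂)^* φ₂`. Here
`qᵢ : L → Iᵢ` are the projections, `jᵢ : aᵢ → A` the inclusions, `E₁`, `E₂` are the induced inner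
products on `a₁`, `a₂`, and pull-backs and the sum are formed on representing cocycles. -/
def Decomposable (E : PseudoEuclidean A) (φ : HQ (E.trivialModule L)) : Prop :=
  ∃ (I₁ I₂ : LieIdeal ℝ L) (a₁ a₂ : Submodule ℝ A)
    (E₁ : PseudoEuclidean a₁) (E₂ : PseudoEuclidean a₂)
    (hI : IsCompl I₁.toSubmodule I₂.toSubmodule),
    IsCompl a₁ a₂ ∧ (∀ x ∈ a₁, ∀ y ∈ a₂, E.form x y = 0) ∧
    (∀ x y : a₁, E₁.form x y = E.form x y) ∧ (∀ x y : a₂, E₂.form x y = E.form x y) ∧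
    ((I₁ ≠ ⊥ ∧ I₂ ≠ ⊥) ∨ (a₁ ≠ ⊥ ∧ a₂ ≠ ⊥)) ∧
    ∃ (c : QuadCocycle (E.trivialModule L))
      (c₁ : QuadCocycle (E₁.trivialModule I₁)) (c₂ : QuadCocycle (E₂.trivialModule I₂)),
      c.cls = φ ∧
      c.α = a₁.subtype.compAlternatingMap
              (c₁.α.compLinearMap (Submodule.projectionOnto _ _ hI))
          + a₂.subtype.compAlternatingMap
              (c₂.α.compLinearMap (Submodule.projectionOnto _ _ hI.symm)) ∧
      c.γ = c₁.γ.compLinearMap (Submodule.projectionOnto _ _ hI)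
          + c₂.γ.compLinearMap (Submodule.projectionOnto _ _ hI.symm)

/-- The set `H²_Q(L, A)₀` of indecomposable admissible classes, `A` a pseudo-Euclidean space
considered as a trivial `L`-module. -/
def HQ0 (E : PseudoEuclidean A) : Set (HQ (E.trivialModule L)) :=
  {φ | Admissible (E.trivialModule L) φ ∧ ¬ Decomposable L E φ}

end Decomposable

/-- The Lie algebra `𝔤₅,₂ = {[X₁, X₂] = Y, [X₁, X₃] = Z}`, in coordinates with respect to the basis
`X₁, X₂, X₃, Y, Z`. -/
def G52 : Type := Fin 5 → ℝ

noncomputable instance : AddCommGroup G52 := inferInstanceAs (AddCommGroup (Fin 5 → ℝ))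

noncomputable instance : Module ℝ G52 := inferInstanceAs (Module ℝ (Fin 5 → ℝ))

/-- The bracket of `𝔤₅,₂`. -/
def G52.br (x y : Fin 5 → ℝ) : Fin 5 → ℝ :=
  ![0, 0, 0, x 0 * y 1 - x 1 * y 0, x 0 * y 2 - x 2 * y 0]

theorem G52.br_add_left (x y z : Fin 5 → ℝ) : br (x + y) z = br x z + br y z := by
  ext i; fin_cases i <;> simp [br] <;> ring

theorem G52.br_add_right (x y z : Fin 5 → ℝ) : br x (y + z) = br x y + br x z := by
  ext i; fin_cases i <;> simp [br] <;> ring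

theorem G52.br_self (x : Fin 5 → ℝ) : br x x = 0 := by
  ext i; fin_cases i <;> simp [br] <;> ring

theorem G52.br_leibniz (x y z : Fin 5 → ℝ) :
    br x (br y z) = br (br x y) z + br y (br x z) := by
  ext i; fin_cases i <;> simp [br]

theorem G52.br_smul (t : ℝ) (x y : Fin 5 → ℝ) : br x (t • y) = t • br x y := by
  ext i; fin_cases i <;> simp [br] <;> ring

noncomputable instance : LieRing G52 where
  bracket x y := G52.br x y
  add_lie x y z := G52.br_add_left x y z
  lie_add x y z := G52.br_add_right x y z
  lie_self x := G52.br_self x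
  leibniz_lie x y z := G52.br_leibniz x y z

noncomputable instance : LieAlgebra ℝ G52 where
  lie_smul t x y := G52.br_smul t x y

/-- The abelian Lie algebra `ℝⁿ`. -/
def AbelianLie (n : ℕ) : Type := Fin n → ℝ

noncomputable instance (n : ℕ) : AddCommGroup (AbelianLie n) :=
  inferInstanceAs (AddCommGroup (Fin n → ℝ))

noncomputable instance (n : ℕ) : Module ℝ (AbelianLie n) :=
  inferInstanceAs (Module ℝ (Fin n → ℝ))

noncomputable instance (n : ℕ) : LieRing (AbelianLie n) where
  bracket _ _ := 0
  add_lie _ _ _ := (add_zero 0).symm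
  lie_add _ _ _ := (add_zero 0).symm
  lie_self _ := rfl
  leibniz_lie _ _ _ := (add_zero 0).symm

noncomputable instance (n : ℕ) : LieAlgebra ℝ (AbelianLie n) where
  lie_smul t _ _ := (smul_zero t).symm

end QuadraticCohomology

/-!
With zero coefficients `γ` is closed. Let `W = Lᵏ⁺¹`, `k ≥ 1`, be the last non-zero term of the
lower central series of a non-abelian `L`. It is central, so `(Aₖ)` says that no non-zero `u ∈ W`
satisfies `γ(L, u, W) = 0`; as `γ` is alternating, this forces `dim W ≥ 2`. Since `L²` has
codimension at least two and the series decreases strictly, `W` is `L²` or `L³`, and `W = L³`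
exactly when `L` is generated by two elements.

For two generators `x`, `y`, the space `L³` is spanned by `d = [x, [x, y]]` and `e = [y, [x, y]]`.
Contracting `γ` with the central elements `d` and `e` gives closed two-forms, and their closedness
yields `γ(L, d, e) = 0`, a contradiction. So `L³ = 0` and `dim L² = 2`. The three brackets of
three generators are then linearly dependent, and a bivector in dimension three is decomposable:
two of the generators can be chosen to commute, which is the presentation of `𝔤₅,₂`.
-/

namespace QuadraticCohomology

section LowerCentralSeries

open LieModule

variable {R L M : Type*} [CommRing R] [LieRing L] [LieAlgebra R L] [AddCommGroup M] [Module R M]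
  [LieRingModule L M] [LieModule R L M]

theorem lowerCentralSeries_succ_le_iff {k : ℕ} {N : Submodule R M} :
    (lowerCentralSeries R L M (k + 1)).toSubmodule ≤ N ↔
      ∀ x : L, ∀ m ∈ lowerCentralSeries R L M k, ⁅x, m⁆ ∈ N := by
  rw [lowerCentralSeries_succ, LieSubmodule.lieIdeal_oper_eq_linear_span', Submodule.span_le]
  exact ⟨fun h x m hm => h ⟨x, trivial, m, hm, rfl⟩, fun h _ ⟨x, _, m, hm, e⟩ => e ▸ h x m hm⟩

theorem lie_mem_lowerCentralSeries_succ {k : ℕ} (x : L) {m : M}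
    (hm : m ∈ lowerCentralSeries R L M k) : ⁅x, m⁆ ∈ lowerCentralSeries R L M (k + 1) :=
  lowerCentralSeries_succ_le_iff.1 le_rfl x m hm

variable (R) in
theorem lie_mem_lowerCentralSeries_one (x : L) (m : M) : ⁅x, m⁆ ∈ lowerCentralSeries R L M 1 :=
  lie_mem_lowerCentralSeries_succ x (LieSubmodule.mem_top m)

theorem lie_mem_lowerCentralSeries_add_two {k : ℕ} {x : L} {m : M}
    (hx : x ∈ lowerCentralSeries R L L 1) (hm : m ∈ lowerCentralSeries R L M k) :
    ⁅x, m⁆ ∈ lowerCentralSeries R L M (k + 2) := by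
  let S := (lowerCentralSeries R L M (k + 2)).toSubmodule.comap
    ((toEnd R L M : L →ₗ[R] Module.End R M).flip m)
  suffices h : (lowerCentralSeries R L L 1).toSubmodule ≤ S from h hx
  refine lowerCentralSeries_succ_le_iff.2 fun y z _ => ?_
  change ⁅⁅y, z⁆, m⁆ ∈ lowerCentralSeries R L M (k + 2)
  have hmem (u v : L) : ⁅u, ⁅v, m⁆⁆ ∈ lowerCentralSeries R L M (k + 2) :=
    lie_mem_lowerCentralSeries_succ u (lie_mem_lowerCentralSeries_succ v hm)
  rw [lie_lie]
  exact sub_mem (hmem y z) (hmem z y)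

theorem lowerCentralSeries_le_maxTrivSubmodule {k : ℕ}
    (h : lowerCentralSeries R L M (k + 1) = ⊥) :
    lowerCentralSeries R L M k ≤ maxTrivSubmodule R L M :=
  (le_max_triv_iff_bracket_eq_bot R L M).2 (lowerCentralSeries_succ R L M k ▸ h)

theorem lowerCentralSeries_succ_le_of_span_sup {k : ℕ} {s : Set L} {t : Set M}
    {N : Submodule R M}
    (hs : Submodule.span R s ⊔ (lowerCentralSeries R L L 1).toSubmodule = ⊤)
    (ht : (lowerCentralSeries R L M k).toSubmodule ≤
      Submodule.span R t ⊔ (lowerCentralSeries R L M (k + 1)).toSubmodule)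
    (hN : (lowerCentralSeries R L M (k + 2)).toSubmodule ≤ N)
    (h : ∀ x ∈ s, ∀ m ∈ t, ⁅x, m⁆ ∈ N) :
    (lowerCentralSeries R L M (k + 1)).toSubmodule ≤ N := by
  refine lowerCentralSeries_succ_le_iff.2 fun x m hm => ?_
  obtain ⟨x₁, hx₁, x₂, hx₂, rfl⟩ := Submodule.mem_sup.1 (hs ▸ Submodule.mem_top : x ∈ _)
  obtain ⟨m₁, hm₁, m₂, hm₂, rfl⟩ := Submodule.mem_sup.1 (ht hm)
  have h₁₁ : ⁅x₁, m₁⁆ ∈ N := LinearMap.BilinMap.apply_apply_mem_of_mem_span N s t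
    (toEnd R L M : L →ₗ[R] Module.End R M) h x₁ m₁ hx₁ hm₁
  have h₁₂ : ⁅x₁, m₂⁆ ∈ N := hN (lie_mem_lowerCentralSeries_succ x₁ hm₂)
  have h₂ : ⁅x₂, m₁ + m₂⁆ ∈ N := hN (lie_mem_lowerCentralSeries_add_two hx₂ hm)
  rw [add_lie, lie_add x₁]
  exact N.add_mem (N.add_mem h₁₁ h₁₂) h₂

theorem lowerCentralSeries_one_le_of_span_range_sup {ι : Type*} [LinearOrder ι] {v : ι → L}
    {N : Submodule R L}
    (hv : Submodule.span R (Set.range v) ⊔ (lowerCentralSeries R L L 1).toSubmodule = ⊤)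
    (hN : (lowerCentralSeries R L L 2).toSubmodule ≤ N) (h : ∀ i j, i < j → ⁅v i, v j⁆ ∈ N) :
    (lowerCentralSeries R L L 1).toSubmodule ≤ N := by
  refine lowerCentralSeries_succ_le_of_span_sup hv (hv ▸ le_top) hN ?_
  rintro _ ⟨i, rfl⟩ _ ⟨j, rfl⟩
  obtain hij | rfl | hji := lt_trichotomy i j
  · exact h i j hij
  · exact lie_self (v i) ▸ N.zero_mem
  · exact lie_skew (v i) (v j) ▸ N.neg_mem (h j i hji)

theorem lowerCentralSeries_one_le_of_pair {v : Fin 2 → L}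
    (hv : Submodule.span R (Set.range v) ⊔ (lowerCentralSeries R L L 1).toSubmodule = ⊤) :
    (lowerCentralSeries R L L 1).toSubmodule ≤
      Submodule.span R {⁅v 0, v 1⁆} ⊔ (lowerCentralSeries R L L 2).toSubmodule := by
  refine lowerCentralSeries_one_le_of_span_range_sup hv le_sup_right fun i j hij => ?_
  obtain ⟨rfl, rfl⟩ : i = 0 ∧ j = 1 := by lia
  exact Submodule.mem_sup_left (Submodule.mem_span_singleton_self _)

theorem lowerCentralSeries_two_le_of_pair {v : Fin 2 → L}
    (hv : Submodule.span R (Set.range v) ⊔ (lowerCentralSeries R L L 1).toSubmodule = ⊤) :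
    (lowerCentralSeries R L L 2).toSubmodule ≤
      Submodule.span R {⁅v 0, ⁅v 0, v 1⁆⁆, ⁅v 1, ⁅v 0, v 1⁆⁆} ⊔
        (lowerCentralSeries R L L 3).toSubmodule := by
  refine lowerCentralSeries_succ_le_of_span_sup hv (lowerCentralSeries_one_le_of_pair hv)
    le_sup_right ?_
  rintro _ ⟨i, rfl⟩ _ rfl
  refine Submodule.mem_sup_left (Submodule.subset_span ?_)
  fin_cases i <;> simp

theorem lowerCentralSeries_eq_bot_of_le_succ [IsNilpotent L M] {k : ℕ}
    (h : lowerCentralSeries R L M k ≤ lowerCentralSeries R L M (k + 1)) :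
    lowerCentralSeries R L M k = ⊥ := by
  have hle (j : ℕ) : lowerCentralSeries R L M k ≤ lowerCentralSeries R L M (k + j) := by
    induction j with
    | zero => exact le_rfl
    | succ j ih =>
      rw [← add_assoc, lowerCentralSeries_succ]
      rw [lowerCentralSeries_succ] at h
      exact h.trans (LieSubmodule.mono_lie_right ⊤ ih)
  obtain ⟨n, hn⟩ := IsNilpotent.nilpotent R L M
  exact eq_bot_iff.2 <|
    (hle n).trans ((antitone_lowerCentralSeries R L M (Nat.le_add_left n k)).trans hn.le)

end LowerCentralSeries

section Dimension

open LieModule Module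

variable {K : Type*} [Field K]

theorem exists_span_range_sup_eq_top {V : Type*} [AddCommGroup V] [Module K V]
    [FiniteDimensional K V] (W : Submodule K V) {n : ℕ} (h : finrank K W + n = finrank K V) :
    ∃ v : Fin n → V, Submodule.span K (Set.range v) ⊔ W = ⊤ := by
  obtain ⟨U, hU⟩ := W.exists_isCompl
  obtain rfl : n = finrank K U := by
    have := Submodule.finrank_add_eq_of_isCompl hU
    lia
  refine ⟨U.subtype ∘ finBasis K U, ?_⟩
  rw [Set.range_comp, ← Submodule.map_span, Basis.span_eq, Submodule.map_subtype_top]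
  exact hU.symm.sup_eq_top

variable {L : Type*} [LieRing L] [LieAlgebra K L]

theorem finrank_lowerCentralSeries_one_le_one_of_pair {v : Fin 2 → L}
    (hv : Submodule.span K (Set.range v) ⊔ (lowerCentralSeries K L L 1).toSubmodule = ⊤)
    (h2 : lowerCentralSeries K L L 2 = ⊥) : finrank K (lowerCentralSeries K L L 1) ≤ 1 := by
  have h := lowerCentralSeries_one_le_of_pair hv
  rw [h2, LieSubmodule.bot_toSubmodule, sup_bot_eq] at h
  calc finrank K (lowerCentralSeries K L L 1)
      ≤ finrank K (Submodule.span K {⁅v 0, v 1⁆}) := Submodule.finrank_mono h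
    _ ≤ 1 := by simpa using finrank_span_le_card (R := K) {⁅v 0, v 1⁆}

variable [FiniteDimensional K L] [LieRing.IsNilpotent L]

theorem finrank_lowerCentralSeries_succ_lt {k : ℕ} (h : lowerCentralSeries K L L k ≠ ⊥) :
    finrank K (lowerCentralSeries K L L (k + 1)) < finrank K (lowerCentralSeries K L L k) := by
  refine Submodule.finrank_lt_finrank_of_lt (lt_of_le_not_ge ?_ fun hle => h ?_)
  · exact antitone_lowerCentralSeries K L L k.le_succ
  · exact lowerCentralSeries_eq_bot_of_le_succ hle

theorem finrank_lowerCentralSeries_one_add_two_le (h : lowerCentralSeries K L L 1 ≠ ⊥) :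
    finrank K (lowerCentralSeries K L L 1) + 2 ≤ finrank K L := by
  by_contra! hlt
  obtain ⟨n, hn⟩ : ∃ n, finrank K L = finrank K (lowerCentralSeries K L L 1) + n :=
    Nat.exists_eq_add_of_le (Submodule.finrank_le (lowerCentralSeries K L L 1).toSubmodule)
  obtain ⟨v, hv⟩ := exists_span_range_sup_eq_top _ hn.symm
  have : Subsingleton (Fin n) := Fin.subsingleton_iff_le_one.2 (by lia)
  refine h (lowerCentralSeries_eq_bot_of_le_succ ?_)
  exact lowerCentralSeries_one_le_of_span_range_sup hv le_rfl fun i j hij =>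
    absurd (Subsingleton.elim i j) hij.ne

theorem finrank_lowerCentralSeries_succ_add_le {k : ℕ}
    (h : lowerCentralSeries K L L (k + 1) ≠ ⊥) :
    finrank K (lowerCentralSeries K L L (k + 1)) + (k + 2) ≤ finrank K L := by
  induction k with
  | zero => exact finrank_lowerCentralSeries_one_add_two_le h
  | succ k ih =>
    have hk : lowerCentralSeries K L L (k + 1) ≠ ⊥ :=
      ne_bot_of_le_ne_bot h (antitone_lowerCentralSeries K L L (k + 1).le_succ)
    have := finrank_lowerCentralSeries_succ_lt hk
    have := ih hk
    lia

end Dimension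

section AlternatingMaps

theorem alternatingMap_apply_rotate {R M N : Type*} [CommRing R] [AddCommGroup M] [Module R M]
    [AddCommGroup N] [Module R N] (f : M [⋀^Fin 3]→ₗ[R] N) (x y z : M) :
    f ![y, z, x] = f ![x, y, z] := by
  have h : ![x, y, z] ∘ finRotate 3 = ![y, z, x] := by
    ext i
    fin_cases i <;> rfl
  rw [← h, f.map_perm, sign_finRotate, Even.neg_one_pow (by decide), one_smul]

theorem alternatingMap_apply_swap {R M N : Type*} [CommRing R] [AddCommGroup M] [Module R M]
    [AddCommGroup N] [Module R N] (f : M [⋀^Fin 2]→ₗ[R] N) (x y : M) :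
    f ![y, x] = -f ![x, y] := by
  rw [← f.map_swap ![x, y] (i := 0) (j := 1) (by decide)]
  congr 1
  ext i
  fin_cases i <;> rfl

variable {L A : Type*} [LieRing L] [LieAlgebra ℝ L] [AddCommGroup A] [Module ℝ A]

theorem alternatingMap_apply_eq_zero_of_mem_span {α : L [⋀^Fin 2]→ₗ[ℝ] A} {s : Set L}
    (h : ∀ x ∈ s, ∀ y ∈ s, α ![x, y] = 0) {x y : L} (hx : x ∈ Submodule.span ℝ s)
    (hy : y ∈ Submodule.span ℝ s) : α ![x, y] = 0 :=
  LinearMap.BilinMap.apply_apply_mem_of_mem_span ⊥ s s (bilin α) h x y hx hy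

end AlternatingMaps

section ClosedForms

variable {L : Type*} [LieRing L] [LieAlgebra ℝ L]

theorem d2R_curryLeft_of_mem_center (γ : L [⋀^Fin 3]→ₗ[ℝ] ℝ) {w : L}
    (hw : w ∈ LieAlgebra.center ℝ L) (x y z : L) :
    d2R (γ.curryLeft w) x y z = d3R γ x y z w := by
  have hw' (u : L) : ⁅u, w⁆ = 0 := hw u
  have hzero (u v : L) : γ ![0, u, v] = 0 := γ.map_coord_zero 0 rfl
  simp [d2R, d3R, hw', hzero, alternatingMap_apply_rotate γ w]

variable {σ : L [⋀^Fin 2]→ₗ[ℝ] ℝ} (hσ : ∀ x y z, d2R σ x y z = 0)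

include hσ

theorem apply_eq_zero_of_mem_lcs_one_of_mem_center {p u : L} (hp : p ∈ lcs L 1)
    (hu : u ∈ LieAlgebra.center ℝ L) : σ ![p, u] = 0 := by
  suffices h : (lcs L 1).toSubmodule ≤ LinearMap.ker ((bilin σ).flip u) from h hp
  refine lowerCentralSeries_succ_le_iff.2 fun x y _ => ?_
  have hu' (z : L) : ⁅z, u⁆ = 0 := hu z
  have hzero (z : L) : σ ![0, z] = 0 := σ.map_coord_zero 0 rfl
  have h := hσ x y u
  rw [d2R, hu', hu', hzero, hzero, add_zero, sub_zero, neg_eq_zero] at h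
  exact h

theorem apply_lie_lie_eq (x y : L) : σ ![⁅x, ⁅x, y⁆⁆, y] = σ ![⁅y, ⁅x, y⁆⁆, x] := by
  have hself : σ ![⁅x, y⁆, ⁅x, y⁆] = 0 := σ.map_eq_zero_of_eq _ (i := 0) (j := 1) rfl (by decide)
  have h := hσ x y ⁅x, y⁆
  rw [d2R, hself] at h
  linarith

end ClosedForms

section ClosedThreeForms

variable {L : Type*} [LieRing L] [LieAlgebra ℝ L]

theorem apply_lie_lie_pair_eq_zero {γ : L [⋀^Fin 3]→ₗ[ℝ] ℝ} (hγ : ∀ x y z w, d3R γ x y z w = 0)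
    {v : Fin 2 → L} (hv : Submodule.span ℝ (Set.range v) ⊔ (lcs L 1).toSubmodule = ⊤)
    (h3 : lcs L 3 = ⊥) (x : L) : γ ![x, ⁅v 0, ⁅v 0, v 1⁆⁆, ⁅v 1, ⁅v 0, v 1⁆⁆] = 0 := by
  have hcenter (i : Fin 2) : ⁅v i, ⁅v 0, v 1⁆⁆ ∈ LieAlgebra.center ℝ L :=
    lowerCentralSeries_le_maxTrivSubmodule h3
      (lie_mem_lowerCentralSeries_succ _ (lie_mem_lowerCentralSeries_one ℝ _ _))
  have hclosed (i : Fin 2) (x y z : L) : d2R (γ.curryLeft ⁅v i, ⁅v 0, v 1⁆⁆) x y z = 0 := by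
    rw [d2R_curryLeft_of_mem_center γ (hcenter i), hγ]
  let d := ⁅v 0, ⁅v 0, v 1⁆⁆
  let e := ⁅v 1, ⁅v 0, v 1⁆⁆
  have h0 : γ ![d, e, v 0] = 0 := by
    refine (apply_lie_lie_eq (hclosed 0) (v 0) (v 1)).symm.trans ?_
    exact γ.map_eq_zero_of_eq _ (i := 0) (j := 1) rfl (by decide)
  have h1 : γ ![e, d, v 1] = 0 := by
    refine (apply_lie_lie_eq (hclosed 1) (v 0) (v 1)).trans ?_
    exact γ.map_eq_zero_of_eq _ (i := 0) (j := 1) rfl (by decide)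
  have hlcs {p : L} (hp : p ∈ lcs L 1) : γ ![e, p, d] = 0 :=
    apply_eq_zero_of_mem_lcs_one_of_mem_center (hclosed 1) hp (hcenter 0)
  have hswap (y : L) : γ ![d, e, y] = -γ ![e, d, y] := by
    rw [alternatingMap_apply_rotate γ y d e, alternatingMap_apply_rotate γ y e d]
    exact alternatingMap_apply_swap (γ.curryLeft y) e d
  suffices h : ⊤ ≤ LinearMap.ker (bilin (γ.curryLeft d) e) by
    rw [← alternatingMap_apply_rotate]
    exact h (Submodule.mem_top (x := x))
  rw [← hv, sup_le_iff, Submodule.span_le]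
  refine ⟨?_, fun p hp => (alternatingMap_apply_rotate γ d e p).symm.trans (hlcs hp)⟩
  rintro _ ⟨i, rfl⟩
  fin_cases i
  exacts [h0, (hswap (v 1)).trans (neg_eq_zero.2 h1)]

theorem apply_eq_zero_of_mem_lcs_two_of_pair {γ : L [⋀^Fin 3]→ₗ[ℝ] ℝ}
    (hγ : ∀ x y z w, d3R γ x y z w = 0) {v : Fin 2 → L}
    (hv : Submodule.span ℝ (Set.range v) ⊔ (lcs L 1).toSubmodule = ⊤) (h3 : lcs L 3 = ⊥)
    (x : L) {u w : L} (hu : u ∈ lcs L 2) (hw : w ∈ lcs L 2) : γ ![x, u, w] = 0 := by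
  have hle : (lcs L 2).toSubmodule ≤ _ ⊔ (lcs L 3).toSubmodule :=
    lowerCentralSeries_two_le_of_pair hv
  rw [h3, LieSubmodule.bot_toSubmodule, sup_bot_eq] at hle
  refine alternatingMap_apply_eq_zero_of_mem_span (α := γ.curryLeft x) ?_ (hle hu) (hle hw)
  have h01 := apply_lie_lie_pair_eq_zero hγ hv h3 x
  have hself (y : L) : γ.curryLeft x ![y, y] = 0 :=
    AlternatingMap.map_eq_zero_of_eq _ _ (i := 0) (j := 1) rfl (by decide)
  rintro _ (rfl | rfl) _ (rfl | rfl)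
  · exact hself _
  · exact h01
  · rw [alternatingMap_apply_swap, neg_eq_zero]
    exact h01
  · exact hself _

end ClosedThreeForms

section TrivialCoefficients

variable {L A : Type*} [LieRing L] [LieAlgebra ℝ L] [AddCommGroup A] [Module ℝ A]
  [Subsingleton A] {V : OrthogonalModule L A} {c : QuadCocycle V}

theorem QuadCocycle.d3R_eq_zero (c : QuadCocycle V) (x y z w : L) : d3R c.γ x y z w = 0 := by
  have h (a : A) : V.form a = 0 := by rw [Subsingleton.elim a 0, map_zero]
  simp [c.d_γ, wedge22, h]

theorem CondA.lcs_eq_bot {k : ℕ} (hA : CondA V c (k + 1)) (hk : lcs L (k + 2) = ⊥)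
    (h : ∀ x, ∀ u ∈ lcs L (k + 1), ∀ w ∈ lcs L (k + 1), c.γ ![x, u, w] = 0) :
    lcs L (k + 1) = ⊥ := by
  refine (LieSubmodule.eq_bot_iff _).2 fun u hu => ?_
  refine hA u ⟨lowerCentralSeries_le_maxTrivSubmodule hk hu, hu⟩ ⟨0, 0, fun x => ?_⟩
  exact ⟨Subsingleton.elim _ _, fun w => by simp [h x u hu w w.2]⟩

theorem CondA.two_le_finrank [FiniteDimensional ℝ L] {k : ℕ} (hA : CondA V c (k + 1))
    (hk : lcs L (k + 2) = ⊥) (hne : lcs L (k + 1) ≠ ⊥) :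
    2 ≤ Module.finrank ℝ (lcs L (k + 1)) := by
  by_contra! hlt
  obtain ⟨v, hv⟩ := ((lcs L (k + 1)).toSubmodule.finrank_le_one_iff_isPrincipal.1
    (Nat.le_of_lt_succ hlt)).principal
  refine hne (hA.lcs_eq_bot hk fun x u hu w hw => ?_)
  rw [← LieSubmodule.mem_toSubmodule, hv] at hu hw
  refine alternatingMap_apply_eq_zero_of_mem_span (α := c.γ.curryLeft x) ?_ hu hw
  rintro _ rfl _ rfl
  exact AlternatingMap.map_eq_zero_of_eq _ _ (i := 0) (j := 1) rfl (by decide)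

theorem CondA.lcs_two_eq_bot_and_finrank_eq_two [LieRing.IsNilpotent L]
    (hL : Module.finrank ℝ L = 5) {k : ℕ} (hA : CondA V c (k + 1)) (hk : lcs L (k + 2) = ⊥)
    (hne : lcs L (k + 1) ≠ ⊥) : lcs L 2 = ⊥ ∧ Module.finrank ℝ (lcs L 1) = 2 := by
  have : FiniteDimensional ℝ L := Module.finite_of_finrank_pos (by lia)
  have h2 := hA.two_le_finrank hk hne
  have hsum := finrank_lowerCentralSeries_succ_add_le hne
  have hpair (h : Module.finrank ℝ (lcs L 1) = 3) :
      ∃ v : Fin 2 → L, Submodule.span ℝ (Set.range v) ⊔ (lcs L 1).toSubmodule = ⊤ :=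
    exists_span_range_sup_eq_top _ (by rw [hL]; exact congrArg (· + 2) h)
  obtain rfl | rfl : k = 0 ∨ k = 1 := by lia
  · refine ⟨hk, ?_⟩
    by_contra h
    obtain ⟨v, hv⟩ := hpair (by lia)
    have := finrank_lowerCentralSeries_one_le_one_of_pair hv hk
    lia
  · have h1 : lcs L 1 ≠ ⊥ :=
      ne_bot_of_le_ne_bot hne (LieModule.antitone_lowerCentralSeries ℝ L L one_le_two)
    have hlt := finrank_lowerCentralSeries_succ_lt h1
    have hsum1 := finrank_lowerCentralSeries_one_add_two_le h1
    obtain ⟨v, hv⟩ := hpair (by lia)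
    refine absurd (hA.lcs_eq_bot hk fun x u hu w hw => ?_) hne
    exact apply_eq_zero_of_mem_lcs_two_of_pair c.d3R_eq_zero hv hk x hu hw

end TrivialCoefficients

section Classification

-- Addition in `Fin 3` is cyclic, so the family below consists of all three pairwise brackets.
theorem exists_lie_eq_zero_of_not_linearIndependent {K L : Type*} [Field K] [LieRing L]
    [LieAlgebra K L] {v : Fin 3 → L}
    (h : ¬ LinearIndependent K fun i => ⁅v (i + 1), v (i + 2)⁆) :
    ∃ w : Fin 3 → L, Submodule.span K (Set.range v) ≤ Submodule.span K (Set.range w) ∧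
      ⁅w 1, w 2⁆ = 0 := by
  obtain ⟨g, hg, i, hi⟩ := Fintype.not_linearIndependent_iff.1 h
  let s := (g i)⁻¹ * g (i + 1)
  let t := (g i)⁻¹ * g (i + 2)
  let w : Fin 3 → L := ![v i, v (i + 1) - s • v i, v (i + 2) - t • v i]
  have hw (j : Fin 3) : w j ∈ Submodule.span K (Set.range w) := Submodule.subset_span ⟨j, rfl⟩
  refine ⟨w, Submodule.span_le.2 ?_, ?_⟩
  · have h1 : v (i + 1) = w 1 + s • w 0 := (sub_add_cancel _ _).symm
    have h2 : v (i + 2) = w 2 + t • w 0 := (sub_add_cancel _ _).symm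
    have hcases : ∀ i j : Fin 3, j = i ∨ j = i + 1 ∨ j = i + 2 := by decide
    rintro _ ⟨j, rfl⟩
    obtain rfl | rfl | rfl := hcases i j
    · exact hw 0
    · exact h1 ▸ add_mem (hw 1) (Submodule.smul_mem _ s (hw 0))
    · exact h2 ▸ add_mem (hw 2) (Submodule.smul_mem _ t (hw 0))
  · have hsum : g i • ⁅v (i + 1), v (i + 2)⁆ + g (i + 1) • ⁅v (i + 2), v i⁆ +
        g (i + 2) • ⁅v i, v (i + 1)⁆ = 0 := by
      rw [Fin.sum_univ_three] at hg
      fin_cases i <;> refine Eq.trans ?_ hg <;>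
        simp only [Fin.zero_eta, Fin.mk_one, Fin.reduceFinMk, Fin.isValue, Fin.reduceAdd,
          zero_add] <;>
        abel
    have hdiv := congrArg ((g i)⁻¹ • ·) hsum
    simp only [smul_add, smul_smul, inv_mul_cancel₀ hi, one_smul, smul_zero] at hdiv
    change ⁅v (i + 1) - s • v i, v (i + 2) - t • v i⁆ = 0
    rw [← hdiv, ← lie_skew (v (i + 2)) (v i), ← lie_skew (v i) (v (i + 1))]
    simp only [sub_lie, lie_sub, smul_lie, lie_smul, lie_self, s, t]
    module

end Classification

section Isomorphisms

variable {L : Type*} [LieRing L] [LieAlgebra ℝ L]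

theorem nonempty_equiv_abelianLie [FiniteDimensional ℝ L] [IsLieAbelian L] :
    Nonempty (L ≃ₗ⁅ℝ⁆ AbelianLie (Module.finrank ℝ L)) := by
  let e : L ≃ₗ[ℝ] AbelianLie (Module.finrank ℝ L) := (Module.finBasis ℝ L).equivFun
  refine ⟨{ e with map_lie' := fun {x y} => ?_ }⟩
  change e ⁅x, y⁆ = 0
  rw [trivial_lie_zero, map_zero]

theorem nonempty_equiv_G52_of_basis (b : Module.Basis (Fin 5) ℝ L) (h01 : ⁅b 0, b 1⁆ = b 3)
    (h02 : ⁅b 0, b 2⁆ = b 4) (h12 : ⁅b 1, b 2⁆ = 0) (h3 : b 3 ∈ LieAlgebra.center ℝ L)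
    (h4 : b 4 ∈ LieAlgebra.center ℝ L) : Nonempty (L ≃ₗ⁅ℝ⁆ G52) := by
  let e : G52 ≃ₗ[ℝ] L := b.equivFun.symm
  have he (x : Fin 5 → ℝ) :
      e x = x 0 • b 0 + x 1 • b 1 + x 2 • b 2 + x 3 • b 3 + x 4 • b 4 := by
    change b.equivFun.symm x = _
    rw [Module.Basis.equivFun_symm_apply, Fin.sum_univ_five]
  have h3' (x : L) : ⁅x, b 3⁆ = 0 := h3 x
  have h4' (x : L) : ⁅x, b 4⁆ = 0 := h4 x
  have h3'' (x : L) : ⁅b 3, x⁆ = 0 := by rw [← lie_skew, h3', neg_zero]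
  have h4'' (x : L) : ⁅b 4, x⁆ = 0 := by rw [← lie_skew, h4', neg_zero]
  have e_lie (x y : Fin 5 → ℝ) : e (G52.br x y) = ⁅e x, e y⁆ := by
    simp only [he, G52.br, add_lie, lie_add, smul_lie, lie_smul, lie_self, h01, h02, h12,
      h3', h4', h3'', h4'', ← lie_skew (b 1) (b 0), ← lie_skew (b 2) (b 0), ← lie_skew (b 2) (b 1)]
    simp only [Matrix.cons_val_zero, Matrix.cons_val_one, Matrix.cons_val]
    module
  exact ⟨LieEquiv.symm { e with map_lie' := fun {x y} => e_lie x y }⟩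

theorem nonempty_equiv_G52_of_lie_eq_zero (hL : Module.finrank ℝ L = 5) (h2 : lcs L 2 = ⊥)
    {v : Fin 3 → L} (hv : Submodule.span ℝ (Set.range v) ⊔ (lcs L 1).toSubmodule = ⊤)
    (h : ⁅v 1, v 2⁆ = 0) : Nonempty (L ≃ₗ⁅ℝ⁆ G52) := by
  let u : Fin 5 → L := ![v 0, v 1, v 2, ⁅v 0, v 1⁆, ⁅v 0, v 2⁆]
  have hu (i : Fin 5) : u i ∈ Submodule.span ℝ (Set.range u) := Submodule.subset_span ⟨i, rfl⟩
  have hlie (x y : L) : ⁅x, y⁆ ∈ LieAlgebra.center ℝ L :=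
    lowerCentralSeries_le_maxTrivSubmodule h2 (lie_mem_lowerCentralSeries_one ℝ x y)
  have htop : ⊤ ≤ Submodule.span ℝ (Set.range u) := by
    rw [← hv, sup_le_iff, Submodule.span_le]
    constructor
    · rintro _ ⟨i, rfl⟩
      fin_cases i
      exacts [hu 0, hu 1, hu 2]
    · have hbot : (lcs L 2).toSubmodule ≤ Submodule.span ℝ (Set.range u) :=
        (congrArg LieSubmodule.toSubmodule h2).trans_le bot_le
      refine lowerCentralSeries_one_le_of_span_range_sup hv hbot fun i j hij => ?_
      obtain ⟨rfl, rfl⟩ | ⟨rfl, rfl⟩ | ⟨rfl, rfl⟩ :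
          (i = 0 ∧ j = 1) ∨ (i = 0 ∧ j = 2) ∨ (i = 1 ∧ j = 2) := by lia
      exacts [hu 3, hu 4, h ▸ Submodule.zero_mem _]
  let b := basisOfTopLeSpanOfCardEqFinrank u htop (by simp [hL])
  have hb (i : Fin 5) : b i = u i := by simp [b]
  refine nonempty_equiv_G52_of_basis b ?_ ?_ ?_ ?_ ?_ <;> simp only [hb]
  exacts [rfl, rfl, h, hlie _ _, hlie _ _]

theorem nonempty_equiv_G52_of_finrank_eq_two (hL : Module.finrank ℝ L = 5) (h2 : lcs L 2 = ⊥)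
    (h1 : Module.finrank ℝ (lcs L 1) = 2) : Nonempty (L ≃ₗ⁅ℝ⁆ G52) := by
  have : FiniteDimensional ℝ L := Module.finite_of_finrank_pos (by lia)
  obtain ⟨v, hv⟩ := exists_span_range_sup_eq_top (n := 3) (lcs L 1).toSubmodule
    (by rw [hL]; exact congrArg (· + 3) h1)
  have hdep : ¬ LinearIndependent ℝ fun i => ⁅v (i + 1), v (i + 2)⁆ := fun hli => by
    let u (i : Fin 3) : lcs L 1 := ⟨_, lie_mem_lowerCentralSeries_one ℝ (v (i + 1)) (v (i + 2))⟩
    have hu : LinearIndependent ℝ u := .of_comp (lcs L 1).toSubmodule.subtype hli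
    simpa [h1] using hu.fintype_card_le_finrank
  obtain ⟨w, hw, hw12⟩ := exists_lie_eq_zero_of_not_linearIndependent hdep
  exact nonempty_equiv_G52_of_lie_eq_zero hL h2 (top_le_iff.1 (hv ▸ sup_le_sup_right hw _)) hw12

end Isomorphisms

end QuadraticCohomology

open QuadraticCohomology in
theorem proposition4_general (L : Type*) [LieRing L] [LieAlgebra ℝ L]
    (hL : Module.finrank ℝ L = 5) (A : Type*) [AddCommGroup A] [Module ℝ A] [Subsingleton A]
    (V : OrthogonalModule L A) (φ : HQ V) (h : Admissible V φ) :
    Nonempty (L ≃ₗ⁅ℝ⁆ AbelianLie 5) ∨ Nonempty (L ≃ₗ⁅ℝ⁆ G52) := by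
  obtain ⟨c, -, -, m, hm, hc⟩ := h
  have : FiniteDimensional ℝ L := Module.finite_of_finrank_pos (by lia)
  have : LieRing.IsNilpotent L := LieModule.IsNilpotent.mk L hm
  by_cases h1 : lcs L 1 = ⊥
  · have : IsLieAbelian L := (LieModule.trivial_iff_lower_central_eq_bot ℝ L L).2 h1
    exact .inl (hL ▸ nonempty_equiv_abelianLie)
  · obtain ⟨k, hne, hk⟩ :=
      Nat.exists_not_and_succ_of_not_zero_of_exists (p := fun n => lcs L (n + 1) = ⊥) h1 ⟨m, hm⟩
    have hkm : k + 1 ≤ m := by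
      by_contra! hlt
      exact hne (eq_bot_iff.2 ((LieModule.antitone_lowerCentralSeries ℝ L L hlt).trans hm.le))
    obtain ⟨h2, hdim⟩ := (hc _ hkm).1.lcs_two_eq_bot_and_finrank_eq_two hL hk hne
    exact .inr (nonempty_equiv_G52_of_finrank_eq_two hL h2 hdim)

theorem proposition4 (L : Type*) [LieRing L] [LieAlgebra ℝ L] [LieRing.IsNilpotent L]
    (hL : Module.finrank ℝ L = 5)
    (A : Type*) [AddCommGroup A] [Module ℝ A] [Subsingleton A]
    (E : QuadraticCohomology.PseudoEuclidean A)
    (h : (QuadraticCohomology.HQ0 L E).Nonempty) :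
    Nonempty (L ≃ₗ⁅ℝ⁆ QuadraticCohomology.AbelianLie 5) ∨
      Nonempty (L ≃ₗ⁅ℝ⁆ QuadraticCohomology.G52) := by
  obtain ⟨φ, hφ, -⟩ := h
  exact proposition4_general L hL A (E.trivialModule L) φ hφ
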